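/- **Setting.** Let $(\mathcal X,d)$ be a compact metric space, $C:\mathcal X\times\mathcal X\to\mathbb R$ a Lipschitz cost, and $\alpha,\beta$ Borel probability measures on $\mathcal X$. For $h\in\mathcal C(\mathcal X)$ put $\|h\|_{\mathrm{var}}=\max h-\min h$. A pair of *optimal potentials* is a pair $(f^\star,g^\star)\in\mathcal C(\mathcal X)^2$ that maximizes $$F_{\alpha,\beta}(f,g)=\int f\,d\alpha+\int g\,d\beta-\iint e^{f(x)+g(y)-C(x,y)}\,d\alpha(x)\,d\beta(y)+1$$ over $\mathcal C(\mathcal X)^2$ and satisfies, for all $x,y\in\mathcal X$, $$f^\star(x)=-\log\int e^{g^\star(y')-C(x,y')}\,d\beta(y'),\qquad g^\star(y)=-\log\int e^{f^\star(x')-C(x',y)}\,d\alpha(x').$$ Let $(x_i)_{i\ge1}$ be i.i.d. with law $\alpha$ and $(y_i)_{i\ge1}$ i.i.d. with law $\beta$. Let $(n(t))_{t\ge0}$ be batch sizes in $\mathbb N$, with $n_0=0$ and $n_{t+1}=n_t+n(t)$. The *fully-corrective online Sinkhorn iterates* are, for $t\ge1$, $$\hat f_t(\cdot)=-\log\sum_{i=1}^{n_t}e^{q_{i,t}-C(\cdot,y_i)},\qquad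 \hat g_t(\cdot)=-\log\sum_{i=1}^{n_t}e^{p_{i,t}-C(x_i,\cdot)},$$ where $p_{i,1}=q_{i,1}=0$ for $1\le i\le n_1$ and, for $t\ge1$ and all $1\le i\le n_{t+1}$, $$q_{i,t+1}=\log\tfrac1{n_{t+1}}+\hat g_t(y_i),\qquad p_{i,t+1}=\log\tfrac1{n_{t+1}}+\hat f_t(x_i).$$ **Growth condition.** There are $B>0$, $w_t>0$ and real step sizes $\eta_t$ $(t\ge1)$ such that $n_t=B/w_t^2$ for all $t\ge1$, $\sum_{t\ge1}w_t\eta_t$ converges absolutely, and $\sum_{t\ge1}\eta_t=+\infty$. (The step sizes enter only through this condition.) **Proposition.** Optimal potentials exist. If the growth condition holds, then for every pair $(f^\star,g^\star)$ of optimal potentials, almost surely, $$\|\hat f_t-f^\star\|_{\mathrm{var}}+\|\hat g_t-g^\star\|_{\mathrm{var}}\longrightarrow0\qquad(t\to\infty).$$ Constant batch sizes are allowed: for every integer $B\ge1$ and every $a\in(1/2,1]$, there are $w_t>0$ such that the growth condition holds with $n(t)=B$ for all $t$, this $B$, and $\eta_t=t^{-a}$. -/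

import Mathlib

open MeasureTheory ProbabilityTheory Filter Topology Finset

noncomputable section

namespace OnlineSinkhorn

/-- Variation norm `max h - min h` of a (continuous) function on a (compact) space. -/
def varNorm {S : Type*} (h : S → ℝ) : ℝ := (⨆ z, h z) - ⨅ z, h z

/-- Soft `C`-transform of `h` with respect to `μ`: `z ↦ -log ∫ exp (h y - C z y) dμ(y)`. -/
def softCTransform {S : Type*} [MeasurableSpace S] (C : S → S → ℝ) (μ : Measure S)
    (h : S → ℝ) (z : S) : ℝ :=
  -Real.log (∫ y, Real.exp (h y - C z y) ∂μ)

/-- Objective of the dual of entropy-regularized optimal transport (regularization `1`). -/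
def dualObjective {S : Type*} [MeasurableSpace S] (C : S → S → ℝ) (α β : Measure S)
    (f g : S → ℝ) : ℝ :=
  (∫ x, f x ∂α) + (∫ y, g y ∂β)
    - (∫ z, Real.exp (f z.1 + g z.2 - C z.1 z.2) ∂(α.prod β)) + 1

/-- Optimal potentials: continuous functions that maximize the dual objective over all pairs of
continuous functions and solve the Sinkhorn equations at every point of the space. (Maximality
alone determines the potentials on the supports of `α` and `β` only; the equations fix their
values elsewhere.) -/
structure IsOptimalPotentials {S : Type*} [TopologicalSpace S] [MeasurableSpace S]
    (C : S → S → ℝ) (α β : Measure S) (f g : C(S, ℝ)) : Prop where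
  isMax : ∀ f' g' : C(S, ℝ), dualObjective C α β f' g' ≤ dualObjective C α β f g
  eq_left : ∀ x, f x = softCTransform C β g x
  eq_right : ∀ y, g y = softCTransform (fun y x => C x y) α f y

/-- Total number of samples drawn before iteration `t`, for the batch sizes `b`. -/
def totalCount (b : ℕ → ℕ) (t : ℕ) : ℕ := ∑ s ∈ range t, b s

/-- `z ↦ -log ∑_{i < n} exp (r i - C z (s i))`: the potential that is stored through the weights
`r` (in log-space) and the positions `s`. -/
def potential {S : Type*} (C : S → S → ℝ) (n : ℕ) (r : ℕ → ℝ) (s : ℕ → S) (z : S) : ℝ :=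
  -Real.log (∑ i ∈ range n, Real.exp (r i - C z (s i)))

/-- The log-weights `(q, p)` of fully-corrective online Sinkhorn after `t` batches, run on the
sample streams `x`, `y` with total sample counts `N`. The first batch (`t = 1`) gets weights `0`;
afterwards the weights of all samples seen so far (those with index `i < N (t + 1)`) are refitted:
`q_{i,t+1} = log (1 / N (t+1)) + g_t (y i)` and `p_{i,t+1} = log (1 / N (t+1)) + f_t (x i)`.
Entries with index `i ≥ N t` of the weights at time `t` are never used, and neither is `t = 0`,
where no sample has been drawn. -/
def weights {S : Type*} (C : S → S → ℝ) (N : ℕ → ℕ) (x y : ℕ → S) : ℕ → (ℕ → ℝ) × (ℕ → ℝ)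
  | 0 => (fun _ => 0, fun _ => 0)
  | 1 => (fun _ => 0, fun _ => 0)
  | t + 2 =>
    let q := (weights C N x y (t + 1)).1
    let p := (weights C N x y (t + 1)).2
    (fun i => Real.log (1 / (N (t + 2) : ℝ))
        + potential (fun y' x' => C x' y') (N (t + 1)) p x (y i),
      fun i => Real.log (1 / (N (t + 2) : ℝ)) + potential C (N (t + 1)) q y (x i))

/-- The iterate `f_t = -log ∑_{i < N t} exp (q_{i,t} - C(·, y_i))`. -/
def fIter {S : Type*} (C : S → S → ℝ) (N : ℕ → ℕ) (x y : ℕ → S) (t : ℕ) : S → ℝ :=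
  potential C (N t) (weights C N x y t).1 y

/-- The iterate `g_t = -log ∑_{i < N t} exp (p_{i,t} - C(x_i, ·))`. -/
def gIter {S : Type*} (C : S → S → ℝ) (N : ℕ → ℕ) (x y : ℕ → S) (t : ℕ) : S → ℝ :=
  potential (fun y' x' => C x' y') (N t) (weights C N x y t).2 x

/-- Growth condition on the total sample counts and the step sizes (indices `t ≥ 1`):
`n_t = B / w_t²`, `∑ w_t η_t < ∞` and `∑ η_t = ∞`. -/
structure GrowthCondition (b : ℕ → ℕ) (η : ℕ → ℝ) (B : ℝ) (w : ℕ → ℝ) : Prop where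
  B_pos : 0 < B
  w_pos : ∀ t, 0 < t → 0 < w t
  count_eq : ∀ t, 0 < t → (totalCount b t : ℝ) = B / w t ^ 2
  summable : Summable fun t => w (t + 1) * η (t + 1)
  diverges : Tendsto (fun T => ∑ t ∈ range T, η (t + 1)) atTop atTop

end OnlineSinkhorn

end

/-! Refitting all weights makes each step an exact soft `C`-transform: f_{t+1} is the transform of
g_t under the empirical measure of the first n_{t+1} samples y_i, and symmetrically for g_{t+1}
(`potential_eq_softCTransform_empirical`). Soft transforms contract the variation norm at a rate
below 1 that depends only on a bound for `C`, hence is common to all the empirical measures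
(`varNorm_softCTransform_sub_le`, `exists_rate`). The error therefore shrinks by this rate at each
step, up to the sampling error in the transforms of the optimal potentials. Since these are
deterministic, a strong law in `C(S, ℝ)` sends the sampling error to 0 almost surely as the sample
grows (`ae_tendsto_varNorm_softCTransform_empirical`). The growth condition forces n_t → ∞, and a
contractive recursion with vanishing perturbations tends to 0.

Existence rests on the same contraction: the composed transforms have a fixed point up to a
constant, comparing total masses shows that the constant is 0, and convexity of exp turns the
Sinkhorn equations into maximality. -/

namespace OnlineSinkhorn

/-! ### Variation norm. -/

section VarNorm

lemma varNorm_le {S : Type*} [Nonempty S] {h : S → ℝ} {c : ℝ} (H : ∀ z z', h z - h z' ≤ c) :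
    varNorm h ≤ c := by
  unfold varNorm
  rw [sub_le_iff_le_add']
  refine ciSup_le fun z => ?_
  rw [← sub_le_iff_le_add]
  exact le_ciInf fun z' => by linarith [H z z']

lemma varNorm_sub_le_of_abs_le {S : Type*} [Nonempty S] {f g : S → ℝ} {c : ℝ} (H : ∀ z, |f z - g z| ≤ c) :
    varNorm (fun z => f z - g z) ≤ 2 * c :=
  varNorm_le fun z z' => by
    have h1 := abs_le.1 (H z)
    have h2 := abs_le.1 (H z')
    linarith

variable {S : Type*} [TopologicalSpace S] [CompactSpace S]

lemma sub_le_varNorm {h : S → ℝ} (hc : Continuous h) (z z' : S) : h z - h z' ≤ varNorm h := by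
  have h1 : h z ≤ ⨆ z, h z := le_ciSup (isCompact_range hc).bddAbove z
  have h2 : ⨅ z, h z ≤ h z' := ciInf_le (isCompact_range hc).bddBelow z'
  unfold varNorm
  linarith

lemma sub_sub_le_varNorm {f g : S → ℝ} (hf : Continuous f) (hg : Continuous g) (z z' : S) :
    f z - g z - (f z' - g z') ≤ varNorm (fun z => f z - g z) :=
  sub_le_varNorm (h := fun z => f z - g z) (hf.sub hg) z z'

lemma varNorm_nonneg [Nonempty S] {h : S → ℝ} (hc : Continuous h) : 0 ≤ varNorm h := by
  obtain ⟨z⟩ := ‹Nonempty S›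
  simpa using sub_le_varNorm hc z z

lemma varNorm_sub_le [Nonempty S] {f g h : S → ℝ} (hf : Continuous f) (hg : Continuous g)
    (hh : Continuous h) :
    varNorm (fun z => f z - h z) ≤ varNorm (fun z => f z - g z) + varNorm (fun z => g z - h z) := by
  refine varNorm_le fun z z' => ?_
  have h1 := sub_sub_le_varNorm hf hg z z'
  have h2 := sub_sub_le_varNorm hg hh z z'
  linarith

end VarNorm

/-! ### Contraction of the soft `C`-transform. -/

section Contraction

/-- Both sides vanish at `r = 0`, where the slope of the left side is exactly `(1 - δ) / (1 + δ)`;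
the slopes differ by a multiple of `(exp r - 1) ^ 2`. -/
lemma log_exp_add_sub_log_le {δ : ℝ} (hδ : 0 < δ) (hδ' : δ ≤ 1) {r : ℝ} (hr : 0 ≤ r) :
    Real.log (Real.exp r + δ) - Real.log (1 + δ * Real.exp r) ≤ (1 - δ) / (1 + δ) * r := by
  have hd : ∀ r : ℝ, HasDerivAt
      (fun r => (1 - δ) / (1 + δ) * r + Real.log (1 + δ * Real.exp r) - Real.log (Real.exp r + δ))
      ((1 - δ) / (1 + δ) + δ * Real.exp r / (1 + δ * Real.exp r)
        - Real.exp r / (Real.exp r + δ)) r := by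
    intro r
    have he := Real.exp_pos r
    refine HasDerivAt.sub (HasDerivAt.add ?_ ?_) ?_
    · simpa using (hasDerivAt_id r).const_mul ((1 - δ) / (1 + δ))
    · exact (((Real.hasDerivAt_exp r).const_mul δ).const_add 1).log (by positivity)
    · exact ((Real.hasDerivAt_exp r).add_const δ).log (by positivity)
  have hmono : Monotone fun r =>
      (1 - δ) / (1 + δ) * r + Real.log (1 + δ * Real.exp r) - Real.log (Real.exp r + δ) := by
    refine monotone_of_deriv_nonneg (fun r => (hd r).differentiableAt) fun r => ?_
    rw [(hd r).deriv]
    have he := Real.exp_pos r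
    have key : (1 - δ) / (1 + δ) + δ * Real.exp r / (1 + δ * Real.exp r)
        - Real.exp r / (Real.exp r + δ)
        = (1 - δ) * δ * (Real.exp r - 1) ^ 2
          / ((1 + δ) * (1 + δ * Real.exp r) * (Real.exp r + δ)) := by
      have h1 : 1 + δ ≠ 0 := by positivity
      have h2 : 1 + δ * Real.exp r ≠ 0 := by positivity
      have h3 : Real.exp r + δ ≠ 0 := by positivity
      field_simp
      ring
    rw [key]
    have : 0 ≤ 1 - δ := by linarith
    positivity
  have := hmono hr
  simp only [mul_zero, Real.exp_zero, mul_one] at this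
  linarith

/-- Eliminating `exp M` and `exp m` between the hypotheses bounds `A / A'` by `(exp r + δ) / (1 + δ
* exp r)` with `r = M - m`. -/
lemma log_sub_log_le {δ A A' m M : ℝ} (hδ : 0 < δ) (hδ' : δ ≤ 1) (hA : 0 < A) (hA' : 0 < A')
    (hm : m ≤ M) (h : A - δ * A' ≤ (1 - δ) * Real.exp M)
    (h' : (1 - δ) * Real.exp m ≤ A' - δ * A) :
    Real.log A - Real.log A' ≤ (1 - δ) / (1 + δ) * (M - m) := by
  have hM : Real.exp M = Real.exp (M - m) * Real.exp m := by rw [← Real.exp_add]; ring_nf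
  have he := Real.exp_pos (M - m)
  have h1 : A * (1 + δ * Real.exp (M - m)) ≤ A' * (Real.exp (M - m) + δ) := by
    rw [hM] at h
    nlinarith [mul_le_mul_of_nonneg_left h' he.le]
  have h2 := Real.log_le_log (by positivity) h1
  rw [Real.log_mul hA.ne' (by positivity), Real.log_mul hA'.ne' (by positivity)] at h2
  have h3 := log_exp_add_sub_log_le hδ hδ' (sub_nonneg.2 hm)
  linarith

lemma continuous_kernel {X : Type*} [TopologicalSpace X] {C : X → X → ℝ}
    (hC : Continuous (Function.uncurry C)) {h : X → ℝ} (hh : Continuous h) (z : X) :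
    Continuous fun y => h y - C z y :=
  hh.sub (hC.comp (by fun_prop : Continuous fun y => (z, y)))

lemma integrable_of_continuous {X : Type*} [TopologicalSpace X] [CompactSpace X]
    [MeasurableSpace X] [OpensMeasurableSpace X] (μ : Measure X) [IsFiniteMeasure μ] {h : X → ℝ}
    (hc : Continuous h) : Integrable h μ :=
  hc.integrable_of_hasCompactSupport (HasCompactSupport.of_compactSpace h)

lemma integral_exp_pos_of_continuous {X : Type*} [TopologicalSpace X] [CompactSpace X]
    [MeasurableSpace X] [OpensMeasurableSpace X] (μ : Measure X) [IsProbabilityMeasure μ]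
    {h : X → ℝ} (hc : Continuous h) : 0 < ∫ y, Real.exp (h y) ∂μ :=
  integral_exp_pos (integrable_of_continuous μ (Real.continuous_exp.comp hc))

variable {S : Type*} [MetricSpace S] [CompactSpace S] [MeasurableSpace S] [BorelSpace S]
  {C : S → S → ℝ} (hC : Continuous (Function.uncurry C)) (μ : Measure S)
  [IsProbabilityMeasure μ]

include hC

lemma continuous_integral_exp {h : S → ℝ} (hh : Continuous h) :
    Continuous fun z => ∫ y, Real.exp (h y - C z y) ∂μ := by
  have : Continuous (Function.uncurry fun z y => Real.exp (h y - C z y)) :=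
    Real.continuous_exp.comp ((hh.comp continuous_snd).sub hC)
  simpa using continuous_parametric_integral_of_continuous (μ := μ) this isCompact_univ

lemma continuous_softCTransform {h : S → ℝ} (hh : Continuous h) :
    Continuous (softCTransform C μ h) :=
  ((continuous_integral_exp hC μ hh).log fun z =>
    (integral_exp_pos_of_continuous μ (continuous_kernel hC hh z)).ne').neg

lemma exp_neg_softCTransform {h : S → ℝ} (hh : Continuous h) (z : S) :
    Real.exp (-softCTransform C μ h z) = ∫ y, Real.exp (h y - C z y) ∂μ := by
  rw [softCTransform, neg_neg, Real.exp_log]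
  exact integral_exp_pos_of_continuous μ (continuous_kernel hC hh z)

lemma softCTransform_sub_le {K : ℝ} (hK : ∀ z z' y, C z y - C z' y ≤ K) {h : S → ℝ}
    (hh : Continuous h) (z z' : S) :
    softCTransform C μ h z - softCTransform C μ h z' ≤ K := by
  have : Real.exp (-softCTransform C μ h z') ≤ Real.exp (K - softCTransform C μ h z) := by
    rw [sub_eq_add_neg, Real.exp_add, exp_neg_softCTransform hC μ hh,
      exp_neg_softCTransform hC μ hh, ← integral_const_mul]
    refine integral_mono
      (integrable_of_continuous μ (Real.continuous_exp.comp (continuous_kernel hC hh z')))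
      ((integrable_of_continuous μ
        (Real.continuous_exp.comp (continuous_kernel hC hh z))).const_mul _) fun y => ?_
    simp only
    rw [← Real.exp_add]
    exact Real.exp_le_exp.2 (by linarith [hK z z' y])
  linarith [Real.exp_le_exp.1 this]

lemma integral_exp_add_softCTransform {h : S → ℝ} (hh : Continuous h) (z : S) :
    ∫ y, Real.exp (h y - C z y + softCTransform C μ h z) ∂μ = 1 := by
  simp_rw [Real.exp_add]
  rw [integral_mul_const, ← exp_neg_softCTransform hC μ hh, ← Real.exp_add]
  simp

/-- The Gibbs weight at `z` dominates a fixed fraction of the one at `z'`. -/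
lemma gibbs_le {K : ℝ} (hK : ∀ z z' y, C z y - C z' y ≤ K) {h : S → ℝ}
    (hh : Continuous h) (z z' y : S) :
    Real.exp (-(2 * K)) * Real.exp (h y - C z' y + softCTransform C μ h z')
      ≤ Real.exp (h y - C z y + softCTransform C μ h z) := by
  rw [← Real.exp_add]
  exact Real.exp_le_exp.2
    (by linarith [hK z z' y, softCTransform_sub_le hC μ hK hh z' z])

lemma integral_exp_add_gibbs {h h' : S → ℝ} (hh' : Continuous h') (z : S) :
    ∫ y, Real.exp (h' y - h y) * Real.exp (h y - C z y + softCTransform C μ h z) ∂μ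
      = Real.exp (softCTransform C μ h z - softCTransform C μ h' z) := by
  rw [sub_eq_add_neg _ (softCTransform C μ h' z), Real.exp_add, exp_neg_softCTransform hC μ hh',
    ← integral_const_mul]
  refine integral_congr_ae (.of_forall fun y => ?_)
  simp only
  rw [← Real.exp_add, ← Real.exp_add]
  ring_nf

/-- The soft `C`-transform is a contraction for the variation norm, uniformly in the measure. -/
theorem varNorm_softCTransform_sub_le {K : ℝ} (hK0 : 0 ≤ K) (hK : ∀ z z' y, C z y - C z' y ≤ K)
    {h h' : S → ℝ} (hh : Continuous h) (hh' : Continuous h') :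
    varNorm (fun z => softCTransform C μ h z - softCTransform C μ h' z)
      ≤ (1 - Real.exp (-(2 * K))) / (1 + Real.exp (-(2 * K))) * varNorm (fun z => h z - h' z) := by
  have : Nonempty S := μ.nonempty_of_neZero
  have hu : Continuous fun y => h' y - h y := hh'.sub hh
  set δ := Real.exp (-(2 * K)) with hδ
  have hδ0 : 0 < δ := Real.exp_pos _
  have hδ1 : δ ≤ 1 := Real.exp_le_one_iff.2 (by linarith)
  obtain ⟨y₁, hy₁⟩ := hu.exists_forall_ge' (x₀ := Classical.arbitrary S) (by simp)
  obtain ⟨y₀, hy₀⟩ := hu.exists_forall_le' (x₀ := Classical.arbitrary S) (by simp)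
  have hw (z : S) : Continuous fun y => Real.exp (h y - C z y + softCTransform C μ h z) :=
    Real.continuous_exp.comp ((continuous_kernel hC hh z).add_const _)
  have he : Continuous fun y => Real.exp (h' y - h y) := Real.continuous_exp.comp hu
  have hint (z : S) := integrable_of_continuous μ (hw z)
  have hint' (z : S) : Integrable (fun y => Real.exp (h' y - h y) *
      Real.exp (h y - C z y + softCTransform C μ h z)) μ :=
    integrable_of_continuous μ (he.mul (hw z))
  -- By `gibbs_le`, the Gibbs measure at `z` minus `δ` times the one at `z'` is positive, of mass `1
  -- - δ`. Integrating `exp (h' - h)` against it gives this bound from the maximum and `hlower` from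
  -- the minimum.
  have hupper (z z' : S) :
      Real.exp (softCTransform C μ h z - softCTransform C μ h' z)
        - δ * Real.exp (softCTransform C μ h z' - softCTransform C μ h' z')
        ≤ (1 - δ) * Real.exp (h' y₁ - h y₁) := by
    rw [← integral_exp_add_gibbs hC μ hh' z, ← integral_exp_add_gibbs hC μ hh' z',
      ← integral_const_mul, ← integral_sub (hint' z) ((hint' z').const_mul _)]
    calc _ ≤ ∫ y, Real.exp (h' y₁ - h y₁) *
          (Real.exp (h y - C z y + softCTransform C μ h z)
            - δ * Real.exp (h y - C z' y + softCTransform C μ h z')) ∂μ := by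
          refine integral_mono ((hint' z).sub ((hint' z').const_mul _))
            (((hint z).sub ((hint z').const_mul _)).const_mul _) fun y => ?_
          have := mul_le_mul_of_nonneg_right (Real.exp_le_exp.2 (hy₁ y))
            (sub_nonneg.2 (gibbs_le hC μ hK hh z z' y))
          simp only
          linarith
      _ = _ := by
          rw [integral_const_mul, integral_sub (hint z) ((hint z').const_mul _),
            integral_const_mul, integral_exp_add_softCTransform hC μ hh,
            integral_exp_add_softCTransform hC μ hh]
          ring
  have hlower (z z' : S) : (1 - δ) * Real.exp (h' y₀ - h y₀) ≤
      Real.exp (softCTransform C μ h z - softCTransform C μ h' z)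
        - δ * Real.exp (softCTransform C μ h z' - softCTransform C μ h' z') := by
    rw [← integral_exp_add_gibbs hC μ hh' z, ← integral_exp_add_gibbs hC μ hh' z',
      ← integral_const_mul, ← integral_sub (hint' z) ((hint' z').const_mul _)]
    calc _ = ∫ y, Real.exp (h' y₀ - h y₀) *
          (Real.exp (h y - C z y + softCTransform C μ h z)
            - δ * Real.exp (h y - C z' y + softCTransform C μ h z')) ∂μ := by
          rw [integral_const_mul, integral_sub (hint z) ((hint z').const_mul _),
            integral_const_mul, integral_exp_add_softCTransform hC μ hh,
            integral_exp_add_softCTransform hC μ hh]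
          ring
      _ ≤ _ := by
          refine integral_mono (((hint z).sub ((hint z').const_mul _)).const_mul _)
            ((hint' z).sub ((hint' z').const_mul _)) fun y => ?_
          have := mul_le_mul_of_nonneg_right (Real.exp_le_exp.2 (hy₀ y))
            (sub_nonneg.2 (gibbs_le hC μ hK hh z z' y))
          simp only
          linarith
  refine varNorm_le fun z z' => ?_
  have key := log_sub_log_le hδ0 hδ1 (Real.exp_pos _) (Real.exp_pos _) (hy₀ y₁)
    (hupper z z') (hlower z' z)
  rw [Real.log_exp, Real.log_exp] at key
  refine key.trans (mul_le_mul_of_nonneg_left ?_ (div_nonneg (by linarith) (by linarith)))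
  have := sub_sub_le_varNorm hh hh' y₀ y₁
  linarith

end Contraction

/-! ### Existence of optimal potentials. -/

section Existence

lemma exists_rate {S : Type*} [MetricSpace S] [CompactSpace S] [MeasurableSpace S] [BorelSpace S]
    {C : S → S → ℝ} (hC : Continuous (Function.uncurry C)) :
    ∃ κ : ℝ, 0 ≤ κ ∧ κ < 1 ∧ ∀ (μ : Measure S) [IsProbabilityMeasure μ] {h h' : S → ℝ},
      Continuous h → Continuous h' →
      varNorm (fun z => softCTransform C μ h z - softCTransform C μ h' z)
        ≤ κ * varNorm (fun z => h z - h' z) := by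
  obtain ⟨K, hK⟩ := isCompact_univ.exists_bound_of_continuousOn hC.continuousOn
  have hK' : ∀ z y, |C z y| ≤ |K| := fun z y => (hK (z, y) trivial).trans (le_abs_self K)
  have he := Real.exp_pos (-(2 * (2 * |K|)))
  have he' : Real.exp (-(2 * (2 * |K|))) ≤ 1 :=
    Real.exp_le_one_iff.2 (by linarith [abs_nonneg K])
  refine ⟨_, div_nonneg (sub_nonneg.2 he') (by positivity), ?_,
    fun μ _ h h' hh hh' => varNorm_softCTransform_sub_le hC μ (K := 2 * |K|) (by positivity)
      (fun z z' y => ?_) hh hh'⟩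
  · rw [div_lt_one (by positivity)]
    linarith
  · linarith [(abs_le.1 (hK' z y)).2, (abs_le.1 (hK' z' y)).1]

variable {S : Type*} [MetricSpace S] [CompactSpace S]

lemma dist_le_varNorm {f f' : C(S, ℝ)} {z₀ : S} (h : f z₀ = f' z₀) :
    dist f f' ≤ varNorm (fun z => f z - f' z) := by
  have : Nonempty S := ⟨z₀⟩
  have h0 : 0 ≤ varNorm (fun z => f z - f' z) := varNorm_nonneg (f.continuous.sub f'.continuous)
  refine (ContinuousMap.dist_le h0).2 fun z => ?_
  have h1 := sub_sub_le_varNorm f.continuous f'.continuous z z₀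
  have h2 := sub_sub_le_varNorm f.continuous f'.continuous z₀ z
  rw [Real.dist_eq, abs_le]
  constructor <;> linarith

lemma varNorm_le_dist [Nonempty S] (f f' : C(S, ℝ)) :
    varNorm (fun z => f z - f' z) ≤ 2 * dist f f' :=
  varNorm_sub_le_of_abs_le fun z => by
    simpa [Real.dist_eq] using ContinuousMap.dist_apply_le_dist (f := f) (g := f') z

/-- A contraction for the variation norm has a fixed point up to an additive constant. -/
lemma exists_eq_add_const [Nonempty S] {T : C(S, ℝ) → C(S, ℝ)} {r : ℝ} (hr0 : 0 ≤ r) (hr1 : r < 1)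
    (hT : ∀ f f', varNorm (fun z => T f z - T f' z) ≤ r * varNorm (fun z => f z - f' z)) :
    ∃ (f : C(S, ℝ)) (c : ℝ), ∀ z, T f z = f z + c := by
  obtain ⟨z₀⟩ := id ‹Nonempty S›
  -- Normalizing at `z₀` lets the variation norm control the sup distance between iterates, so they
  -- are Cauchy. `Φ` itself is only shown `2 * r`-Lipschitz for that distance, which suffices to
  -- pass to the limit.
  let Φ : C(S, ℝ) → C(S, ℝ) := fun f => T f - ContinuousMap.const S (T f z₀)
  have hΦ0 (f : C(S, ℝ)) : Φ f z₀ = 0 := by simp [Φ]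
  have hΦ (f f' : C(S, ℝ)) :
      varNorm (fun z => Φ f z - Φ f' z) ≤ r * varNorm (fun z => f z - f' z) := by
    refine (varNorm_le fun z z' => ?_).trans (hT f f')
    have := sub_sub_le_varNorm (T f).continuous (T f').continuous z z'
    simp only [Φ, ContinuousMap.sub_apply, ContinuousMap.const_apply]
    linarith
  have hlip : LipschitzWith (r * 2).toNNReal Φ := LipschitzWith.of_dist_le_mul fun f f' => by
    rw [Real.coe_toNNReal _ (by positivity)]
    refine (dist_le_varNorm ((hΦ0 f).trans (hΦ0 f').symm)).trans ((hΦ f f').trans ?_)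
    nlinarith [varNorm_le_dist f f']
  have hzero (n : ℕ) : (Φ^[n] 0) z₀ = 0 := by
    cases n with
    | zero => simp
    | succ n => rw [Function.iterate_succ_apply']; exact hΦ0 _
  have hvar (n : ℕ) : varNorm (fun z => (Φ^[n] 0) z - (Φ^[n + 1] 0) z)
      ≤ varNorm (fun z => (0 : C(S, ℝ)) z - Φ 0 z) * r ^ n := by
    induction n with
    | zero => simp
    | succ n ih =>
      rw [Function.iterate_succ_apply', Function.iterate_succ_apply' _ (n + 1)]
      refine (hΦ _ _).trans ((mul_le_mul_of_nonneg_left ih hr0).trans (le_of_eq ?_))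
      ring
  have hcauchy : CauchySeq fun n => Φ^[n] 0 := cauchySeq_of_le_geometric r _ hr1 fun n =>
    (dist_le_varNorm ((hzero n).trans (hzero (n + 1)).symm)).trans (hvar n)
  obtain ⟨f, hf⟩ := cauchySeq_tendsto_of_complete hcauchy
  have hfix : Φ f = f := isFixedPt_of_tendsto_iterate hf hlip.continuous.continuousAt
  refine ⟨f, T f z₀, fun z => ?_⟩
  have := DFunLike.congr_fun hfix z
  simp only [Φ, ContinuousMap.sub_apply, ContinuousMap.const_apply] at this
  linarith

lemma continuous_uncurry_flip {X : Type*} [TopologicalSpace X] {C : X → X → ℝ}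
    (hC : Continuous (Function.uncurry C)) :
    Continuous (Function.uncurry fun y x => C x y) :=
  hC.comp continuous_swap

lemma continuous_exp_plan {X : Type*} [TopologicalSpace X] {C : X → X → ℝ}
    (hC : Continuous (Function.uncurry C)) {f g : X → ℝ} (hf : Continuous f) (hg : Continuous g) :
    Continuous fun z : X × X => Real.exp (f z.1 + g z.2 - C z.1 z.2) :=
  Real.continuous_exp.comp (((hf.comp continuous_fst).add (hg.comp continuous_snd)).sub hC)

variable [MeasurableSpace S] [BorelSpace S] {C : S → S → ℝ}
  (hC : Continuous (Function.uncurry C)) (α β : Measure S)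
  [IsProbabilityMeasure α] [IsProbabilityMeasure β]

include hC

lemma integral_exp_plan_left {f g : S → ℝ} {c : ℝ} (hg : Continuous g) {x : S}
    (h : softCTransform C β g x = f x + c) :
    ∫ y, Real.exp (f x + g y - C x y) ∂β = Real.exp (-c) := by
  simp_rw [add_sub_assoc, Real.exp_add (f x)]
  rw [integral_const_mul, ← exp_neg_softCTransform hC β hg, h, ← Real.exp_add]
  ring_nf

/-- The plan with density `exp (f + g - C)` has first marginal `exp (-c)` times `α`. The constant is
kept because the fixed point is first known only up to `c`. -/
lemma integral_mul_exp_plan_fst {f g φ : S → ℝ} {c : ℝ} (hf : Continuous f) (hg : Continuous g)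
    (hφ : Continuous φ) (h : ∀ x, softCTransform C β g x = f x + c) :
    ∫ z, φ z.1 * Real.exp (f z.1 + g z.2 - C z.1 z.2) ∂(α.prod β)
      = (∫ x, φ x ∂α) * Real.exp (-c) := by
  have hc : Continuous fun z : S × S => φ z.1 * Real.exp (f z.1 + g z.2 - C z.1 z.2) :=
    (hφ.comp continuous_fst).mul (continuous_exp_plan hC hf hg)
  rw [integral_prod _ (integrable_of_continuous _ hc), ← integral_mul_const]
  refine integral_congr_ae (.of_forall fun x => ?_)
  simp only
  rw [integral_const_mul, integral_exp_plan_left hC β hg (h x)]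

lemma integral_mul_exp_plan_snd {f g φ : S → ℝ} {c : ℝ} (hf : Continuous f) (hg : Continuous g)
    (hφ : Continuous φ) (h : ∀ y, softCTransform (fun y x => C x y) α f y = g y + c) :
    ∫ z, φ z.2 * Real.exp (f z.1 + g z.2 - C z.1 z.2) ∂(α.prod β)
      = (∫ y, φ y ∂β) * Real.exp (-c) := by
  rw [← integral_mul_exp_plan_fst (continuous_uncurry_flip hC) β α hg hf hφ h,
    ← integral_prod_swap]
  simp only [Prod.fst_swap, Prod.snd_swap, add_comm]

/-- Solutions of the Sinkhorn equations maximize the dual objective. -/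
lemma isOptimalPotentials_of_eq {f g : C(S, ℝ)} (hfg : ∀ x, f x = softCTransform C β g x)
    (hgf : ∀ y, g y = softCTransform (fun y x => C x y) α f y) :
    IsOptimalPotentials C α β f g := by
  refine ⟨fun f' g' => ?_, hfg, hgf⟩
  have hf := f.continuous
  have hg := g.continuous
  have hf' := f'.continuous
  have hg' := g'.continuous
  have hfg0 : ∀ x, softCTransform C β g x = f x + 0 := fun x => by rw [add_zero, hfg]
  have hgf0 : ∀ y, softCTransform (fun y x => C x y) α f y = g y + 0 :=
    fun y => by rw [add_zero, hgf]
  have hu := continuous_exp_plan hC hf hg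
  have i0 := integral_mul_exp_plan_fst hC α β hf hg continuous_one hfg0
  have i1 := integral_mul_exp_plan_fst hC α β hf hg (hf'.sub hf) hfg0
  have i2 := integral_mul_exp_plan_snd hC α β hf hg (hg'.sub hg) hgf0
  simp only [Pi.one_apply, one_mul, integral_const, probReal_univ, smul_eq_mul, neg_zero,
    Real.exp_zero, mul_one, Pi.sub_apply] at i0 i1 i2
  rw [integral_sub (integrable_of_continuous α hf') (integrable_of_continuous α hf)] at i1
  rw [integral_sub (integrable_of_continuous β hg') (integrable_of_continuous β hg)] at i2
  have c1 : Continuous fun z : S × S =>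
      (f' z.1 - f z.1) * Real.exp (f z.1 + g z.2 - C z.1 z.2) := by fun_prop
  have c2 : Continuous fun z : S × S =>
      (g' z.2 - g z.2) * Real.exp (f z.1 + g z.2 - C z.1 z.2) := by fun_prop
  -- Tangent-line bound for exp at `f + g - C`. By the marginal identities its linear terms
  -- integrate to the change in the linear part of the objective.
  have key : ∫ z, (Real.exp (f z.1 + g z.2 - C z.1 z.2)
        + (f' z.1 - f z.1) * Real.exp (f z.1 + g z.2 - C z.1 z.2)
        + (g' z.2 - g z.2) * Real.exp (f z.1 + g z.2 - C z.1 z.2)) ∂(α.prod β)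
      ≤ ∫ z, Real.exp (f' z.1 + g' z.2 - C z.1 z.2) ∂(α.prod β) := by
    refine integral_mono (integrable_of_continuous _ ((hu.add c1).add c2))
      (integrable_of_continuous _ (continuous_exp_plan hC hf' hg')) fun z => ?_
    have e : Real.exp (f' z.1 + g' z.2 - C z.1 z.2)
        = Real.exp ((f' z.1 - f z.1) + (g' z.2 - g z.2))
          * Real.exp (f z.1 + g z.2 - C z.1 z.2) := by
      rw [← Real.exp_add]
      ring_nf
    have := mul_le_mul_of_nonneg_right
      (Real.add_one_le_exp ((f' z.1 - f z.1) + (g' z.2 - g z.2)))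
      (Real.exp_pos (f z.1 + g z.2 - C z.1 z.2)).le
    simp only
    rw [e]
    linarith
  have c0 : Continuous fun z : S × S => Real.exp (f z.1 + g z.2 - C z.1 z.2)
      + (f' z.1 - f z.1) * Real.exp (f z.1 + g z.2 - C z.1 z.2) := hu.add c1
  rw [integral_add (integrable_of_continuous _ c0) (integrable_of_continuous _ c2),
    integral_add (integrable_of_continuous _ hu) (integrable_of_continuous _ c1), i0, i1, i2] at key
  unfold dualObjective
  rw [i0]
  linarith

theorem exists_isOptimalPotentials : ∃ f g : C(S, ℝ), IsOptimalPotentials C α β f g := by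
  have : Nonempty S := α.nonempty_of_neZero
  have hC' := continuous_uncurry_flip hC
  obtain ⟨κ, hκ0, hκ1, hκ⟩ := exists_rate hC
  obtain ⟨κ', hκ'0, hκ'1, hκ'⟩ := exists_rate hC'
  let T' : C(S, ℝ) → C(S, ℝ) := fun f => ⟨_, continuous_softCTransform hC' α f.continuous⟩
  let T : C(S, ℝ) → C(S, ℝ) := fun g => ⟨_, continuous_softCTransform hC β g.continuous⟩
  obtain ⟨f, c, hfc⟩ := exists_eq_add_const (T := fun f => T (T' f)) (mul_nonneg hκ0 hκ'0)
    (mul_lt_one_of_nonneg_of_lt_one_left hκ0 hκ1 hκ'1.le) fun f f' => by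
      refine (hκ β (T' f).continuous (T' f').continuous).trans ?_
      rw [mul_assoc]
      exact mul_le_mul_of_nonneg_left (hκ' α f.continuous f'.continuous) hκ0
  -- The mass of the plan is `exp (-c)` by its first marginal and 1 by its second, as `T' f` is an
  -- exact transform.
  have hc : c = 0 := by
    have i1 := integral_mul_exp_plan_fst hC α β f.continuous (T' f).continuous continuous_one hfc
    have i2 := integral_mul_exp_plan_snd hC α β f.continuous (T' f).continuous continuous_one
      (c := 0) fun y => (add_zero _).symm
    simp only [Pi.one_apply, one_mul, integral_const, probReal_univ, smul_eq_mul, neg_zero,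
      Real.exp_zero] at i1 i2
    rw [i1] at i2
    linarith [Real.exp_eq_one_iff _ |>.1 i2]
  refine ⟨f, T' f, isOptimalPotentials_of_eq hC α β (fun x => ?_) fun y => rfl⟩
  rw [← add_zero (f x), ← hc, ← hfc]
  rfl

end Existence

/-! ### Empirical measures and stored potentials. -/

section Empirical

variable {S : Type*} [MeasurableSpace S]

/-- Empirical measure of the first `n` points of a sequence. -/
noncomputable def empirical (s : ℕ → S) (n : ℕ) : Measure S :=
  (n : ENNReal)⁻¹ • ∑ i ∈ range n, Measure.dirac (s i)

lemma isProbabilityMeasure_empirical (s : ℕ → S) {n : ℕ} (hn : n ≠ 0) :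
    IsProbabilityMeasure (empirical s n) := by
  constructor
  simp [empirical, ENNReal.inv_mul_cancel, hn]

lemma integral_empirical [MeasurableSingletonClass S] (s : ℕ → S) (n : ℕ) (h : S → ℝ) :
    ∫ y, h y ∂(empirical s n) = (n : ℝ)⁻¹ * ∑ i ∈ range n, h (s i) := by
  rw [empirical, integral_smul_measure,
    integral_finsetSum_measure fun i _ => integrable_dirac (by simp)]
  simp

/-- The term `log (1 / n)` in the refitted weights is the normalization of the empirical measure. -/
lemma potential_eq_softCTransform_empirical [MeasurableSingletonClass S] (C : S → S → ℝ)
    (s : ℕ → S) {n : ℕ} (hn : n ≠ 0) (h : S → ℝ) :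
    potential C n (fun i => Real.log (1 / (n : ℝ)) + h (s i)) s
      = softCTransform C (empirical s n) h := by
  funext z
  rw [potential, softCTransform, integral_empirical, mul_sum]
  have : (0 : ℝ) < n := by positivity
  simp_rw [add_sub_assoc, Real.exp_add, Real.exp_log (one_div_pos.2 this), one_div]

lemma continuous_potential {S : Type*} [TopologicalSpace S] {C : S → S → ℝ}
    (hC : Continuous (Function.uncurry C)) (n : ℕ) (r : ℕ → ℝ) (s : ℕ → S) :
    Continuous (potential C n r s) := by
  have hcont (i : ℕ) : Continuous fun z => Real.exp (r i - C z (s i)) :=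
    Real.continuous_exp.comp
      (continuous_const.sub (hC.comp (by fun_prop : Continuous fun z => (z, s i))))
  rcases n.eq_zero_or_pos with rfl | hn
  · unfold potential
    simpa using continuous_const
  · refine ((continuous_finsetSum _ fun i _ => hcont i).log fun z => ?_).neg
    exact (sum_pos (fun i _ => Real.exp_pos _) ⟨0, mem_range.2 hn⟩).ne'

end Empirical

/-! ### Uniform law of large numbers. -/

lemma abs_log_sub_log_le {a b c d : ℝ} (hc : 0 < c) (hb : c ≤ b) (hab : |a - b| ≤ d)
    (hd : d ≤ c / 2) : |Real.log a - Real.log b| ≤ 2 * d / c := by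
  obtain ⟨h1, h2⟩ := abs_le.1 hab
  have hb0 : 0 < b := by linarith
  have ha0 : c / 2 ≤ a := by linarith
  have ha : 0 < a := by linarith
  have e1 := Real.log_le_sub_one_of_pos (div_pos ha hb0)
  have e2 := Real.log_le_sub_one_of_pos (div_pos hb0 ha)
  rw [Real.log_div ha.ne' hb0.ne'] at e1
  rw [Real.log_div hb0.ne' ha.ne'] at e2
  have hd0 : 0 ≤ d := (abs_nonneg _).trans hab
  have b1 : a / b - 1 ≤ 2 * d / c := by
    rw [div_sub_one hb0.ne', div_le_div_iff₀ hb0 hc]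
    nlinarith
  have b2 : b / a - 1 ≤ 2 * d / c := by
    rw [div_sub_one ha.ne', div_le_div_iff₀ ha hc]
    nlinarith
  rw [abs_le]
  constructor <;> linarith

/-- By compactness `b` has a positive minimum, so log is Lipschitz on the values that matter once `a
n` is uniformly close to `b`. -/
lemma tendsto_varNorm_neg_log {S : Type*} [TopologicalSpace S] [CompactSpace S] [Nonempty S]
    {a : ℕ → C(S, ℝ)} {b : C(S, ℝ)} (hab : Tendsto a atTop (𝓝 b)) (hb : ∀ z, 0 < b z)
    (ha : ∀ᶠ n in atTop, Continuous fun z => -Real.log (a n z)) :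
    Tendsto (fun n => varNorm fun z => -Real.log (a n z) - -Real.log (b z)) atTop (𝓝 0) := by
  obtain ⟨z₀, hz₀⟩ := b.continuous.exists_forall_le' (x₀ := Classical.arbitrary S) (by simp)
  have hd : Tendsto (fun n => dist (a n) b) atTop (𝓝 0) := tendsto_iff_dist_tendsto_zero.1 hab
  have hbc : Continuous fun z => -Real.log (b z) :=
    (b.continuous.log fun z => (hb z).ne').neg
  have hlim : Tendsto (fun n => 2 * (2 * dist (a n) b / b z₀)) atTop (𝓝 0) := by
    simpa using ((hd.const_mul 2).div_const (b z₀)).const_mul 2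
  refine squeeze_zero' ?_ ?_ hlim
  · filter_upwards [ha] with n hn using varNorm_nonneg (hn.sub hbc)
  · filter_upwards [hd.eventually_le_const (half_pos (hb z₀))] with n hn
    refine varNorm_sub_le_of_abs_le fun z => ?_
    rw [neg_sub_neg, abs_sub_comm]
    exact abs_log_sub_log_le (hb z₀) (hz₀ z)
      (by simpa [Real.dist_eq] using ContinuousMap.dist_apply_le_dist (f := a n) (g := b) z) hn

/-- Uniform law of large numbers for the soft `C`-transform of a fixed potential. -/
theorem ae_tendsto_varNorm_softCTransform_empirical {S : Type*} [MetricSpace S] [CompactSpace S]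
    [MeasurableSpace S] [BorelSpace S] {Ω : Type*} [MeasurableSpace Ω] {P : Measure Ω}
    [IsProbabilityMeasure P] {C : S → S → ℝ} (hC : Continuous (Function.uncurry C))
    {μ : Measure S} {s : ℕ → Ω → S} (hs : ∀ i, Measurable (s i)) (hsμ : ∀ i, P.map (s i) = μ)
    (hsi : iIndepFun s P) (h : C(S, ℝ)) :
    ∀ᵐ ω ∂P, Tendsto (fun n => varNorm fun z =>
      softCTransform C (empirical (fun i => s i ω) n) h z - softCTransform C μ h z)
      atTop (𝓝 0) := by
  have : IsProbabilityMeasure μ := hsμ 0 ▸ Measure.isProbabilityMeasure_map (hs 0).aemeasurable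
  have : Nonempty S := μ.nonempty_of_neZero
  let _ : MeasurableSpace C(S, ℝ) := borel _
  have : BorelSpace C(S, ℝ) := ⟨rfl⟩
  -- Each sample becomes a random element of the Banach space `C(S, ℝ)`; the strong law there is
  -- already uniform in `z`.
  let k : C(S, C(S, ℝ)) := ContinuousMap.curry ⟨fun p : S × S => Real.exp (h p.1 - C p.2 p.1),
    Real.continuous_exp.comp ((h.continuous.comp continuous_fst).sub (hC.comp continuous_swap))⟩
  have hk (y z : S) : k y z = Real.exp (h y - C z y) := rfl
  have hkm : Measurable k := k.continuous.measurable
  have hks : StronglyMeasurable k := k.continuous.stronglyMeasurable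
  have hint : Integrable (fun ω => k (s 0 ω)) P :=
    Integrable.of_bound (hks.comp_measurable (hs 0)).aestronglyMeasurable ‖k‖
      (.of_forall fun ω => k.norm_coe_le_norm _)
  have hlaw := strong_law_ae (fun i ω => k (s i ω)) hint
    (fun i j hij => (hsi.indepFun hij).comp hkm hkm)
    (fun i => IdentDistrib.comp ⟨(hs i).aemeasurable, (hs 0).aemeasurable,
      (hsμ i).trans (hsμ 0).symm⟩ hkm)
  have hlim (z : S) : (∫ ω, k (s 0 ω) ∂P) z = ∫ y, Real.exp (h y - C z y) ∂μ := by
    rw [ContinuousMap.integral_apply hint, ← hsμ 0, integral_map (hs 0).aemeasurable]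
    · simp only [hk]
    · exact (Real.continuous_exp.comp (continuous_kernel hC h.continuous z)).aestronglyMeasurable
  filter_upwards [hlaw] with ω hω
  have havg (n : ℕ) (z : S) : ((n : ℝ)⁻¹ • ∑ i ∈ range n, k (s i ω)) z
      = ∫ y, Real.exp (h y - C z y) ∂(empirical (fun i => s i ω) n) := by
    rw [integral_empirical]
    simp [hk]
  have key := tendsto_varNorm_neg_log hω (fun z => by
    rw [hlim]
    exact integral_exp_pos_of_continuous μ (continuous_kernel hC h.continuous z)) <| by
      filter_upwards [eventually_ne_atTop 0] with n hn
      have := isProbabilityMeasure_empirical (fun i => s i ω) hn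
      simp only [havg]
      exact continuous_softCTransform hC _ h.continuous
  simpa only [softCTransform, havg, hlim] using key

/-- A contractive recursion with vanishing perturbations tends to zero. -/
lemma tendsto_zero_of_le_mul_add {e ε : ℕ → ℝ} {κ : ℝ} (hκ0 : 0 ≤ κ) (hκ1 : κ < 1)
    (he : ∀ t, 0 ≤ e t) (hε : Tendsto ε atTop (𝓝 0)) (hrec : ∀ t, e (t + 1) ≤ κ * e t + ε t) :
    Tendsto e atTop (𝓝 0) := by
  rw [Metric.tendsto_atTop]
  intro η hη
  -- With perturbations below `(1 - κ) * (η / 2)`, the level `η / 2` is preserved: `κ * (η / 2) + (1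
  -- - κ) * (η / 2) = η / 2`.
  obtain ⟨t₀, ht₀⟩ := eventually_atTop.1
    (hε.eventually_le_const (mul_pos (sub_pos.2 hκ1) (half_pos hη)))
  have hb (n : ℕ) : e (t₀ + n) ≤ κ ^ n * e t₀ + η / 2 := by
    induction n with
    | zero => simpa using (half_pos hη).le
    | succ n ih =>
      have h1 := hrec (t₀ + n)
      have h2 := ht₀ (t₀ + n) (by omega)
      have h3 := mul_le_mul_of_nonneg_left ih hκ0
      rw [← add_assoc, pow_succ']
      linarith
  have hpow : Tendsto (fun n => κ ^ n * e t₀) atTop (𝓝 0) := by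
    simpa using (tendsto_pow_atTop_nhds_zero_of_lt_one hκ0 hκ1).mul_const (e t₀)
  obtain ⟨n₀, hn₀⟩ := eventually_atTop.1 (hpow.eventually_lt_const (half_pos hη))
  refine ⟨t₀ + n₀, fun t ht => ?_⟩
  obtain ⟨n, rfl⟩ := Nat.exists_eq_add_of_le (show t₀ ≤ t by omega)
  rw [Real.dist_eq, sub_zero, abs_of_nonneg (he _)]
  linarith [hb n, hn₀ n (by omega)]

/-! ### Consequences and instances of the growth condition. -/

lemma GrowthCondition.totalCount_ne_zero {b : ℕ → ℕ} {η : ℕ → ℝ} {B : ℝ} {w : ℕ → ℝ}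
    (h : GrowthCondition b η B w) {t : ℕ} (ht : 0 < t) : totalCount b t ≠ 0 := by
  have h1 := h.count_eq t ht
  have h2 : 0 < B / w t ^ 2 := div_pos h.B_pos (pow_pos (h.w_pos t ht) 2)
  rw [← h1] at h2
  exact_mod_cast h2.ne'

lemma totalCount_mono (b : ℕ → ℕ) : Monotone (totalCount b) := fun _ _ h =>
  sum_le_sum_of_subset (range_mono h)

/-- Under the growth condition the number of samples tends to infinity: otherwise the weights `w`
would be bounded below and the step sizes summable. -/
lemma GrowthCondition.tendsto_totalCount {b : ℕ → ℕ} {η : ℕ → ℝ} {B : ℝ} {w : ℕ → ℝ}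
    (h : GrowthCondition b η B w) : Tendsto (totalCount b) atTop atTop := by
  refine tendsto_atTop_atTop_of_monotone (totalCount_mono b) fun M => ?_
  by_contra! hM
  have hB := h.B_pos
  have hM0 : (0 : ℝ) < M := by
    have := hM 0
    exact_mod_cast (Nat.zero_le _).trans_lt this
  have hw (t : ℕ) : √(B / M) ≤ w (t + 1) := by
    have hw0 := h.w_pos (t + 1) t.succ_pos
    refine Real.sqrt_le_iff.2 ⟨hw0.le, ?_⟩
    have h1 := h.count_eq (t + 1) t.succ_pos
    have h2 : (totalCount b (t + 1) : ℝ) ≤ M := by exact_mod_cast (hM (t + 1)).le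
    rw [h1, div_le_iff₀ (by positivity)] at h2
    rw [div_le_iff₀ hM0]
    linarith
  have hs : 0 < √(B / M) := Real.sqrt_pos.2 (by positivity)
  -- The steps may change sign, so the comparison uses norms; summability in `ℝ` is absolute.
  have hsum : Summable fun t => η (t + 1) := by
    refine Summable.of_norm_bounded (h.summable.norm.mul_left (√(B / M))⁻¹) fun t => ?_
    rw [norm_mul, Real.norm_of_nonneg (h.w_pos (t + 1) t.succ_pos).le, ← mul_assoc]
    refine le_mul_of_one_le_left (norm_nonneg _) ?_
    rw [inv_mul_eq_div, one_le_div hs]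
    exact hw t
  exact not_tendsto_nhds_of_tendsto_atTop h.diverges _ hsum.hasSum.tendsto_sum_nat

/-- Here `n_t = m * t` forces `w t = t ^ (-1/2)`. Then `w t * η t = t ^ (-(1/2 + a))` is summable as
`a > 1/2`, while the steps diverge as `a ≤ 1`. -/
lemma growthCondition_const {m : ℕ} {a : ℝ} (hm : 0 < m) (ha : 1 / 2 < a) (ha1 : a ≤ 1) :
    GrowthCondition (fun _ => m) (fun t => 1 / (t : ℝ) ^ a) m
      (fun t => 1 / (t : ℝ) ^ (1 / 2 : ℝ)) where
  B_pos := by exact_mod_cast hm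
  w_pos t ht := by positivity
  count_eq t ht := by
    rw [← Real.sqrt_eq_rpow, div_pow, Real.sq_sqrt (by positivity)]
    simp [totalCount, mul_comm]
  summable := by
    have h : Summable fun t : ℕ => 1 / (t : ℝ) ^ (1 / 2 + a) :=
      Real.summable_one_div_nat_rpow.2 (by linarith)
    refine ((summable_nat_add_iff 1).2 h).congr fun t => ?_
    rw [Real.rpow_add (by positivity), one_div_mul_one_div]
  diverges := by
    refine (not_summable_iff_tendsto_nat_atTop_of_nonneg fun t => by positivity).1 fun h => ?_
    have := Real.summable_one_div_nat_rpow.1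
      ((summable_nat_add_iff (f := fun t : ℕ => 1 / (t : ℝ) ^ a) 1).1 h)
    linarith

/-! ### Error recursion for the iterates. -/

section Iterates

variable {S : Type*} [MetricSpace S] [CompactSpace S] [MeasurableSpace S] [BorelSpace S]
  {C : S → S → ℝ} (hC : Continuous (Function.uncurry C)) {N : ℕ → ℕ} {x y : ℕ → S}

lemma fIter_add_two {t : ℕ} (hN : N (t + 2) ≠ 0) :
    fIter C N x y (t + 2)
      = softCTransform C (empirical y (N (t + 2))) (gIter C N x y (t + 1)) :=
  potential_eq_softCTransform_empirical C y hN (gIter C N x y (t + 1))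

lemma gIter_add_two {t : ℕ} (hN : N (t + 2) ≠ 0) :
    gIter C N x y (t + 2)
      = softCTransform (fun y x => C x y) (empirical x (N (t + 2))) (fIter C N x y (t + 1)) :=
  potential_eq_softCTransform_empirical _ x hN (fIter C N x y (t + 1))

include hC

/-- Passing through the transform of `g` under `ν` confines the sampling error to the fixed `g`,
where the law of large numbers applies; the iterate `h` depends on the samples. -/
lemma varNorm_softCTransform_sub_le_add {κ : ℝ} (ν μ : Measure S) [IsProbabilityMeasure ν]
    [IsProbabilityMeasure μ] {g h : S → ℝ} (hh : Continuous h) (hg : Continuous g)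
    (hκ : varNorm (fun z => softCTransform C ν h z - softCTransform C ν g z)
      ≤ κ * varNorm (fun z => h z - g z)) :
    varNorm (fun z => softCTransform C ν h z - softCTransform C μ g z)
      ≤ κ * varNorm (fun z => h z - g z)
        + varNorm (fun z => softCTransform C ν g z - softCTransform C μ g z) := by
  have : Nonempty S := μ.nonempty_of_neZero
  exact (varNorm_sub_le (continuous_softCTransform hC ν hh) (continuous_softCTransform hC ν hg)
    (continuous_softCTransform hC μ hg)).trans (by gcongr)

/-- Convergence of the iterates along sample streams for which the soft `C`-transforms of the
optimal potentials under the empirical measures converge. -/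
theorem tendsto_varNorm_iterates {α β : Measure S} [IsProbabilityMeasure α]
    [IsProbabilityMeasure β] (hN : ∀ t, 0 < t → N t ≠ 0) (hNt : Tendsto N atTop atTop)
    {f g : C(S, ℝ)} (hfg : ∀ x, f x = softCTransform C β g x)
    (hgf : ∀ y, g y = softCTransform (fun y x => C x y) α f y)
    (hy : Tendsto (fun n => varNorm fun z =>
      softCTransform C (empirical y n) g z - softCTransform C β g z) atTop (𝓝 0))
    (hx : Tendsto (fun n => varNorm fun z =>
      softCTransform (fun y x => C x y) (empirical x n) f z
        - softCTransform (fun y x => C x y) α f z) atTop (𝓝 0)) :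
    Tendsto (fun t => varNorm (fun z => fIter C N x y t z - f z)
      + varNorm (fun z => gIter C N x y t z - g z)) atTop (𝓝 0) := by
  have : Nonempty S := α.nonempty_of_neZero
  have hC' := continuous_uncurry_flip hC
  obtain ⟨κ, hκ0, hκ1, hκ⟩ := exists_rate hC
  obtain ⟨κ', hκ'0, hκ'1, hκ'⟩ := exists_rate hC'
  have hF (t : ℕ) : Continuous (fIter C N x y t) := continuous_potential hC _ _ _
  have hG (t : ℕ) : Continuous (gIter C N x y t) := continuous_potential hC' _ _ _
  have hf0 (t : ℕ) : 0 ≤ varNorm (fun z => fIter C N x y t z - f z) :=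
    varNorm_nonneg ((hF t).sub f.continuous)
  have hg0 (t : ℕ) : 0 ≤ varNorm (fun z => gIter C N x y t z - g z) :=
    varNorm_nonneg ((hG t).sub g.continuous)
  -- Shift by 2: the recursion starts from the error at time 1, whose weights are not refitted, and
  -- iterate `t + 2` uses `N (t + 2)` samples.
  have hε := (hy.add hx).comp (hNt.comp (tendsto_add_atTop_nat 2))
  rw [add_zero] at hε
  refine (tendsto_add_atTop_iff_nat 1).1 (tendsto_zero_of_le_mul_add (le_max_of_le_left hκ0)
    (max_lt hκ1 hκ'1) (fun t => add_nonneg (hf0 _) (hg0 _)) hε fun t => ?_)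
  have hNp := hN (t + 2) (by omega)
  have := isProbabilityMeasure_empirical x hNp
  have := isProbabilityMeasure_empirical y hNp
  have h1 := varNorm_softCTransform_sub_le_add hC (empirical y (N (t + 2))) β (hG (t + 1))
    g.continuous (hκ _ (hG (t + 1)) g.continuous)
  have h2 := varNorm_softCTransform_sub_le_add hC' (empirical x (N (t + 2))) α (hF (t + 1))
    f.continuous (hκ' _ (hF (t + 1)) f.continuous)
  -- The two errors swap roles at each step, so their sum contracts at the larger of the two rates.
  have h3 := mul_le_mul_of_nonneg_right (le_max_left κ κ') (hg0 (t + 1))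
  have h4 := mul_le_mul_of_nonneg_right (le_max_right κ κ') (hf0 (t + 1))
  simp only [← fIter_add_two (C := C) (x := x) (y := y) hNp, ← hfg] at h1
  simp only [← gIter_add_two (C := C) (x := x) (y := y) hNp, ← hgf] at h2
  simp only [Function.comp_apply, ← hfg, ← hgf]
  linarith

end Iterates

end OnlineSinkhorn
theorem mainTheorem6 {S : Type*} [MetricSpace S] [CompactSpace S] [MeasurableSpace S]
    [BorelSpace S] {Ω : Type*} [MeasurableSpace Ω] (P : Measure Ω) [IsProbabilityMeasure P]
    (C : S → S → ℝ) (L : NNReal) (hC : LipschitzWith L (fun z : S × S => C z.1 z.2))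
    (α β : Measure S) [IsProbabilityMeasure α] [IsProbabilityMeasure β]
    (x y : ℕ → Ω → S) (hx : ∀ i, Measurable (x i)) (hy : ∀ i, Measurable (y i))
    (hxα : ∀ i, P.map (x i) = α) (hyβ : ∀ i, P.map (y i) = β)
    (hxi : iIndepFun x P) (hyi : iIndepFun y P) :
    (∃ fstar gstar : C(S, ℝ), OnlineSinkhorn.IsOptimalPotentials C α β fstar gstar) ∧
    (∀ (b : ℕ → ℕ) (η : ℕ → ℝ) (B : ℝ) (w : ℕ → ℝ),
      OnlineSinkhorn.GrowthCondition b η B w →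
      ∀ fstar gstar : C(S, ℝ), OnlineSinkhorn.IsOptimalPotentials C α β fstar gstar →
        ∀ᵐ ω ∂P, Tendsto
          (fun t =>
            OnlineSinkhorn.varNorm (fun z =>
              OnlineSinkhorn.fIter C (OnlineSinkhorn.totalCount b)
                (fun i => x i ω) (fun i => y i ω) t z - fstar z)
            + OnlineSinkhorn.varNorm (fun z =>
              OnlineSinkhorn.gIter C (OnlineSinkhorn.totalCount b)
                (fun i => x i ω) (fun i => y i ω) t z - gstar z))
          atTop (𝓝 0)) ∧
    (∀ (m : ℕ) (a : ℝ), 0 < m → 1 / 2 < a → a ≤ 1 →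
      ∃ w : ℕ → ℝ,
        OnlineSinkhorn.GrowthCondition (fun _ => m) (fun t => 1 / (t : ℝ) ^ a) m w) := by
  have hCc : Continuous (Function.uncurry C) := hC.continuous
  refine ⟨OnlineSinkhorn.exists_isOptimalPotentials hCc α β, ?_,
    fun m a hm ha ha1 => ⟨_, OnlineSinkhorn.growthCondition_const hm ha ha1⟩⟩
  intro b η B w hgrowth f g hfg
  -- Randomness enters only through these two almost sure events, one per stream; on their
  -- intersection the argument is deterministic.
  filter_upwards [OnlineSinkhorn.ae_tendsto_varNorm_softCTransform_empirical hCc hy hyβ hyi g,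
    OnlineSinkhorn.ae_tendsto_varNorm_softCTransform_empirical
      (OnlineSinkhorn.continuous_uncurry_flip hCc) hx hxα hxi f] with ω h1 h2
  exact OnlineSinkhorn.tendsto_varNorm_iterates hCc (fun t ht => hgrowth.totalCount_ne_zero ht)
    hgrowth.tendsto_totalCount hfg.eq_left hfg.eq_right h1 h2
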